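/- Let $d\ge 1$ and let $\Phi=(\Phi_j)_{0\le j<d}$ and $\Psi=(\Psi_j)_{0\le j<d}$ be two orthonormal bases of $\mathbb{C}^d$ that are mutually unbiased, i.e. $\max_{0\le j,k<d}|\langle \Phi_j,\Psi_k\rangle| = 1/\sqrt{d}$. For a subset $E\subset\{0,\dots,d-1\}$ and $a=\sum_i a_i\Phi_i\in\mathbb{C}^d$ write $\|a\|_{\ell^2(\Phi,E)}=\bigl(\sum_{i\in E}|a_i|^2\bigr)^{1/2}$, and similarly for $\Psi$; let $\|a\|$ be the Euclidean norm of $a$ and let $E^c$ be the complement of $E$ in $\{0,\dots,d-1\}$. Let $S,\Sigma\subset\{0,\dots,d-1\}$ satisfy $|S|+|\Sigma|=d$ and $|\Sigma|<d$. Then there is a subset $\sigma\subset S$ with $$|\sigma|\ge \frac{(d-|\Sigma|)^2}{240\,d}$$ such that, for every $a\in\mathbb{C}^d$, $$\|a\|\le \frac{13}{\sqrt{1-|\Sigma|/d}}\Bigl(\|a\|_{\ell^2(\Phi,\sigma^c)}+\|a\|_{\ell^2(\Psi,\Sigma^c)}\Bigr).$$ -/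

import Mathlib

/-- The coherence `M(Φ, Ψ) = max_{j,k} |⟨Φ_j, Ψ_k⟩|` of two finite systems of vectors of `ℂ^d`. -/
noncomputable def coherence {d : ℕ} (Φ Ψ : Fin d → EuclideanSpace ℂ (Fin d)) : ℝ :=
  ⨆ p : Fin d × Fin d, ‖inner ℂ (Φ p.1) (Ψ p.2)‖

/-- Two orthonormal bases of `ℂ^d` are (mutually) unbiased when their coherence is `1 / √d`. -/
def IsUnbiased {d : ℕ} (Φ Ψ : OrthonormalBasis (Fin d) ℂ (EuclideanSpace ℂ (Fin d))) : Prop :=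
  coherence Φ Ψ = 1 / √(d : ℝ)

/-- `‖a‖_{ℓ²(Φ, E)}`: the `ℓ²` norm over the indices in `E` of the coordinates `a_i` of
`a = ∑ i, a_i Φ_i` in the basis `Φ`. -/
noncomputable def basisNormOn {d : ℕ} (Φ : OrthonormalBasis (Fin d) ℂ (EuclideanSpace ℂ (Fin d)))
    (E : Finset (Fin d)) (a : EuclideanSpace ℂ (Fin d)) : ℝ :=
  √(∑ i ∈ E, ‖Φ.repr a i‖ ^ 2)

/-!
Write `β = 1 - |Σ| / d` and let `v j` be the coordinate vector of `Φ j` in the basis `Ψ`, set to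
zero on `Σ`. Unbiasedness gives `‖v j‖² ≥ β`, and `(v j)` is a Bessel system with constant `1`. If
`σ ⊆ S` is such that `(v j)_{j ∈ σ}` has lower Riesz bound `3β / 16`, then the part `x` of `a`
carried by `σ` in the basis `Φ` is controlled by its `Ψ`-coordinates off `Σ`, hence by those of `a`
and by the norm of `a - x`; this is the required inequality, with room in the constant.

The existence of a large `σ` is the restricted invertibility theorem (`restricted_invertibility`),
proved by the barrier method of Spielman and Srivastava in a variational form. For a finite set `σ`
of indices already chosen, with synthesis map `T c = ∑ i ∈ σ, c i • v i`, and a barrier `b`, the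
potential is a lower bound for `∑ k ∈ S, min_c (‖v k - T c‖² - b ‖c‖²)`; finiteness of the minima
forces `‖T c‖² ≥ b ‖c‖²` (`mul_norm_sq_le_of_shift`). Lowering the barrier to `b'` raises the
potential by `(b - b') ∑ ‖c k‖²`, where `c k` are the minimisers. Adjoining `v j` changes the `k`-th
minimum by a Schur complement term `|⟨v k, u j⟩|² / s j`, where `u j = v j - T (c j)` and `s j` is
the `j`-th minimum minus `b'`. By the Bessel bound the total cost is at most `‖u j‖² / s j`, and
averaging over `j` (`exists_pos_mul_sum_le`) produces a `j` for which the gain from lowering the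
barrier pays for all but `2` of it (`barrier_step`).
-/

/-! ### Averaging -/

open Finset in
/-- Averaging: if `∑ s > 0`, some index with `s j > 0` has `w j / s j` at most the ratio of the
sums. -/
lemma exists_pos_mul_sum_le {ι : Type*} (S : Finset ι) (s w : ι → ℝ) (hw : ∀ k ∈ S, 0 ≤ w k)
    (hs : 0 < ∑ k ∈ S, s k) :
    ∃ j ∈ S, 0 < s j ∧ w j * ∑ k ∈ S, s k ≤ s j * ∑ k ∈ S, w k := by
  classical
  have hle : ∑ k ∈ S, s k ≤ ∑ k ∈ S with 0 < s k, s k := by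
    rw [← sum_filter_add_sum_filter_not S (fun k => 0 < s k)]
    have : ∑ k ∈ S with ¬ 0 < s k, s k ≤ 0 :=
      sum_nonpos fun k hk => not_lt.1 (mem_filter.1 hk).2
    linarith
  have hne : (S.filter fun k => 0 < s k).Nonempty := by
    by_contra h
    rw [not_nonempty_iff_eq_empty.1 h] at hle
    simp at hle
    linarith
  have hwle : ∑ k ∈ S with 0 < s k, w k ≤ ∑ k ∈ S, w k :=
    sum_le_sum_of_subset_of_nonneg (filter_subset _ _) fun k hk _ => hw k hk
  obtain ⟨j, hj, hle'⟩ := exists_le_of_sum_le hne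
    (f := fun j => w j * ∑ k ∈ S, s k) (g := fun j => s j * ∑ k ∈ S, w k) (by
      rw [← sum_mul, ← sum_mul]
      have : 0 ≤ ∑ k ∈ S, w k := sum_nonneg hw
      nlinarith)
  exact ⟨j, (mem_filter.1 hj).1, (mem_filter.1 hj).2, hle'⟩

/-! ### The barrier step -/

section Barrier

variable {K H : Type*} [NormedAddCommGroup K] [InnerProductSpace ℂ K]
  [NormedAddCommGroup H] [InnerProductSpace ℂ H]

/-- A lower bound, quadratic in `c`, for the affine map `c ↦ x - T c` passes to its linear part. -/
lemma mul_norm_sq_le_of_shift (T : K →ₗ[ℂ] H) (x : H) (r b : ℝ)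
    (h : ∀ c, r + b * ‖c‖ ^ 2 ≤ ‖x - T c‖ ^ 2) (c : K) : b * ‖c‖ ^ 2 ≤ ‖T c‖ ^ 2 := by
  by_contra! hlt
  set D := b * ‖c‖ ^ 2 - ‖T c‖ ^ 2 with hD
  have hDpos : 0 < D := by linarith
  -- Averaging the bound at `±t c` removes the cross term.
  have key : ∀ t : ℝ, t ^ 2 * D ≤ ‖x‖ ^ 2 - r := by
    intro t
    have h1 := h ((t : ℂ) • c)
    have h2 := h (-((t : ℂ) • c))
    have h3 := parallelogram_law_with_norm ℂ x (T ((t : ℂ) • c))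
    rw [map_neg, sub_neg_eq_add, norm_neg] at h2
    simp only [map_smul, norm_smul, Complex.norm_real, Real.norm_eq_abs, mul_pow, sq_abs]
      at h1 h2 h3
    rw [hD]
    nlinarith
  have h5 := key (√((‖x‖ ^ 2 - r + 1) / D))
  have h6 : 0 ≤ ‖x‖ ^ 2 - r := by simpa using key 0
  rw [Real.sq_sqrt (by positivity), div_mul_cancel₀ _ hDpos.ne'] at h5
  linarith

/-- Critical points of `c ↦ ‖x - T c‖² - b ‖c‖²` exist when that function is strictly convex. -/
lemma exists_critical [FiniteDimensional ℂ K] [CompleteSpace H] (T : K →ₗ[ℂ] H) (b : ℝ)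
    (hT : ∀ c, c ≠ 0 → b * ‖c‖ ^ 2 < ‖T c‖ ^ 2) (x : H) :
    ∃ c, ∀ e, inner ℂ (T e) (x - T c) = -(b : ℂ) * inner ℂ e c := by
  set T' : K →L[ℂ] H := LinearMap.toContinuousLinearMap T with hT'
  have hTT : ∀ c, T' c = T c := fun c => rfl
  have : CompleteSpace K := FiniteDimensional.complete ℂ K
  set L : K →ₗ[ℂ] K := (T'.adjoint.comp T').toLinearMap - (b : ℂ) • LinearMap.id with hL
  have hLe : ∀ e c, inner ℂ e (L c) = inner ℂ (T e) (T c) - (b : ℂ) * inner ℂ e c := by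
    intro e c
    simp [hL, ContinuousLinearMap.adjoint_inner_right, hTT]
  have hinj : Function.Injective L := by
    rw [injective_iff_map_eq_zero]
    intro c hc
    by_contra hne
    have h1 := hLe c c
    rw [hc, inner_zero_right, inner_self_eq_norm_sq_to_K, inner_self_eq_norm_sq_to_K] at h1
    have h2 : ‖T c‖ ^ 2 - b * ‖c‖ ^ 2 = 0 := by
      have h1' : ((‖T c‖ ^ 2 - b * ‖c‖ ^ 2 : ℝ) : ℂ) = 0 := by
        push_cast; exact h1.symm
      exact_mod_cast h1'
    linarith [hT c hne]
  obtain ⟨c, hc⟩ := LinearMap.injective_iff_surjective.1 hinj (T'.adjoint x)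
  refine ⟨c, fun e => ?_⟩
  have h1 := hLe e c
  rw [hc, ContinuousLinearMap.adjoint_inner_right, hTT] at h1
  rw [inner_sub_right, h1]
  ring

/-- A critical point is a minimiser. -/
lemma critical_le (T : K →ₗ[ℂ] H) (b : ℝ) (hT : ∀ c, b * ‖c‖ ^ 2 ≤ ‖T c‖ ^ 2) (x : H) (c₀ : K)
    (hc : ∀ e, inner ℂ (T e) (x - T c₀) = -(b : ℂ) * inner ℂ e c₀) (c : K) :
    ‖x - T c₀‖ ^ 2 - b * ‖c₀‖ ^ 2 ≤ ‖x - T c‖ ^ 2 - b * ‖c‖ ^ 2 := by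
  -- Expanding around `c₀`, the linear terms cancel and `‖T e‖² - b ‖e‖² ≥ 0` remains.
  obtain ⟨e, rfl⟩ : ∃ e, c = c₀ + e := ⟨c - c₀, by simp⟩
  have h1 : x - T (c₀ + e) = (x - T c₀) - T e := by rw [map_add]; abel
  rw [h1]
  generalize x - T c₀ = y at hc
  rw [norm_sub_sq (𝕜 := ℂ) y, norm_add_sq (𝕜 := ℂ), inner_re_symm (𝕜 := ℂ) y,
    inner_re_symm (𝕜 := ℂ) c₀, hc e]
  have h2 : RCLike.re (-(b : ℂ) * inner ℂ e c₀) = - b * RCLike.re (inner ℂ e c₀ : ℂ) := by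
    simp
  rw [h2]
  nlinarith [hT e]

open Finset in
/-- One step of the barrier argument: after lowering the barrier from `b` to `b'`, some vector
`v j` can be adjoined to the range of `T` at a cost of at most `2` in the potential `∑ r`. -/
lemma barrier_step [FiniteDimensional ℂ K] [CompleteSpace H] {ι : Type*} (S : Finset ι)
    (v : ι → H) (hv : ∀ u, ∑ k ∈ S, ‖inner ℂ (v k) u‖ ^ 2 ≤ ‖u‖ ^ 2)
    (τ : ℝ) (hτ : τ = ∑ k ∈ S, ‖v k‖ ^ 2) (hτ0 : 0 < τ)
    (T : K →ₗ[ℂ] H) (r : ι → ℝ) (b b' : ℝ) (hb' : 0 < b') (hbb : b' < b)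
    (hr : ∀ k ∈ S, ∀ c, r k + b * ‖c‖ ^ 2 ≤ ‖v k - T c‖ ^ 2)
    (hsum : S.card * b' + τ / 2 ≤ ∑ k ∈ S, r k) (hδ : 2 * b' ≤ (b - b') * τ) :
    ∃ j ∈ S, ∃ r' : ι → ℝ, ∑ k ∈ S, r k - 2 ≤ ∑ k ∈ S, r' k ∧
      ∀ k ∈ S, ∀ c, ∀ t : ℂ,
        r' k + b' * (‖t‖ ^ 2 + ‖c‖ ^ 2) ≤ ‖v k - (t • v j + T c)‖ ^ 2 := by
  obtain ⟨k₀, hk₀⟩ : S.Nonempty := by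
    by_contra h
    rw [not_nonempty_iff_eq_empty.1 h] at hτ
    simp at hτ
    linarith
  have hTb := mul_norm_sq_le_of_shift T (v k₀) (r k₀) b (hr k₀ hk₀)
  have hTlt : ∀ c, c ≠ 0 → b' * ‖c‖ ^ 2 < ‖T c‖ ^ 2 := by
    intro c hc
    have : 0 < ‖c‖ ^ 2 := by positivity
    nlinarith [hTb c]
  have hTle : ∀ c, b' * ‖c‖ ^ 2 ≤ ‖T c‖ ^ 2 := by
    intro c
    have : 0 ≤ ‖c‖ ^ 2 := by positivity
    nlinarith [hTb c]
  choose C hC using fun k => exists_critical T b' hTlt (v k)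
  set u : ι → H := fun k => v k - T (C k) with hu
  set ρ : ι → ℝ := fun k => ‖u k‖ ^ 2 - b' * ‖C k‖ ^ 2 with hρ
  have hρr : ∀ k ∈ S, r k + (b - b') * ‖C k‖ ^ 2 ≤ ρ k := by
    intro k hk
    have := hr k hk (C k)
    simp only [hρ, hu]
    linarith
  have hρv : ∀ k, ρ k ≤ ‖v k‖ ^ 2 := by
    intro k
    have h1 := critical_le T b' hTle (v k) (C k) (hC k) 0
    simpa [hρ, hu] using h1
  set X := ∑ k ∈ S, ρ k with hX
  set N := ∑ k ∈ S, ‖C k‖ ^ 2 with hN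
  have hN0 : 0 ≤ N := sum_nonneg fun k _ => by positivity
  have hXτ : X ≤ τ := by rw [hτ]; exact sum_le_sum fun k _ => hρv k
  have hXr : ∑ k ∈ S, r k + (b - b') * N ≤ X := by
    rw [hN, mul_sum, ← sum_add_distrib]; exact sum_le_sum hρr
  have hsX : ∑ k ∈ S, (ρ k - b') = X - S.card * b' := by
    rw [sum_sub_distrib, sum_const, nsmul_eq_mul]
  have huX : ∑ k ∈ S, ‖u k‖ ^ 2 = X + b' * N := by
    rw [hN, mul_sum, hX, ← sum_add_distrib]
    exact sum_congr rfl fun k _ => by simp [hρ]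
  -- On average the cost `‖u j‖² / s j` of adjoining `v j` is at most the ratio of `∑ ‖u k‖²` and
  -- `∑ s k`, and the latter sum is at least `τ / 2`.
  have hδN : 0 ≤ (b - b') * N := mul_nonneg (by linarith) hN0
  have hspos : τ / 2 ≤ ∑ k ∈ S, (ρ k - b') := by rw [hsX]; linarith
  obtain ⟨j, hj, hsj, hjle⟩ := exists_pos_mul_sum_le S (fun k => ρ k - b') (fun k => ‖u k‖ ^ 2)
    (fun k _ => by positivity) (by linarith)
  rw [huX] at hjle
  set s := ρ j - b' with hs
  have hcost : ‖u j‖ ^ 2 / s ≤ 2 + (b - b') * N := by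
    rw [div_le_iff₀ hsj]
    have h1 : ‖u j‖ ^ 2 * (τ / 2) ≤ s * (τ + b' * N) := by
      have : 0 ≤ ‖u j‖ ^ 2 := by positivity
      nlinarith
    have h2 : s * (τ + b' * N) ≤ s * (τ / 2 * (2 + (b - b') * N)) := by
      apply mul_le_mul_of_nonneg_left _ hsj.le
      nlinarith
    have h3 : ‖u j‖ ^ 2 * (τ / 2) ≤ ((2 + (b - b') * N) * s) * (τ / 2) := by nlinarith
    exact le_of_mul_le_mul_right h3 (by linarith)
  refine ⟨j, hj, fun k => ρ k - ‖(inner ℂ (v k) (u j) : ℂ)‖ ^ 2 / s, ?_, ?_⟩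
  · rw [sum_sub_distrib, ← sum_div]
    have : (∑ k ∈ S, ‖(inner ℂ (v k) (u j) : ℂ)‖ ^ 2) / s ≤ ‖u j‖ ^ 2 / s :=
      div_le_div_of_nonneg_right (hv _) hsj.le
    linarith
  · intro k _ c t
    -- The minimiser depends linearly on the shift, so it is `C k - t • C j` for `v k - t • v j`.
    have hcrit : ∀ e, inner ℂ (T e) (v k - t • v j - T (C k - t • C j)) =
        -(b' : ℂ) * inner ℂ e (C k - t • C j) := by
      intro e
      have h1 : v k - t • v j - T (C k - t • C j) = (v k - T (C k)) - t • (v j - T (C j)) := by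
        rw [map_sub, map_smul, smul_sub]; abel
      rw [h1, inner_sub_right, inner_smul_right, hC, hC, inner_sub_right, inner_smul_right]
      ring
    have hmin := critical_le T b' hTle _ _ hcrit c
    have h1 : v k - t • v j - T (C k - t • C j) = u k - t • u j := by
      simp only [hu]; rw [map_sub, map_smul, smul_sub]; abel
    -- the polar form of the minimal value is `⟨v k, u j⟩`
    have hpol : (inner ℂ (v k) (u j) : ℂ) = inner ℂ (u k) (u j) - b' * inner ℂ (C k) (C j) := by
      have h2 : v k = u k + T (C k) := by simp [hu]
      rw [h2, inner_add_left, hC j (C k)]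
      ring
    have hexp : ‖u k - t • u j‖ ^ 2 - b' * ‖C k - t • C j‖ ^ 2 =
        ρ k + ‖t‖ ^ 2 * ρ j - 2 * (t * inner ℂ (v k) (u j)).re := by
      rw [norm_sub_sq (𝕜 := ℂ) (u k), norm_sub_sq (𝕜 := ℂ) (C k), inner_smul_right, inner_smul_right, hpol,
        norm_smul, norm_smul]
      have h3 : (t * ((inner ℂ (u k) (u j) : ℂ) - b' * inner ℂ (C k) (C j))).re =
          (t * inner ℂ (u k) (u j)).re - b' * (t * inner ℂ (C k) (C j)).re := by
        rw [mul_sub, mul_left_comm, Complex.sub_re, Complex.re_ofReal_mul]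
      rw [h3]
      simp only [hρ, RCLike.re_to_complex]
      ring
    rw [h1, hexp] at hmin
    -- The remaining quadratic in `t`, with leading coefficient `s > 0`, is bounded below by its
    -- minimum.
    have hre : (t * inner ℂ (v k) (u j) : ℂ).re ≤ ‖t‖ * ‖(inner ℂ (v k) (u j) : ℂ)‖ := by
      rw [← norm_mul]; exact Complex.re_le_norm _
    have hsq : 2 * (‖t‖ * ‖(inner ℂ (v k) (u j) : ℂ)‖) ≤
        s * ‖t‖ ^ 2 + ‖(inner ℂ (v k) (u j) : ℂ)‖ ^ 2 / s := by
      set y := ‖(inner ℂ (v k) (u j) : ℂ)‖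
      have h4 : s * ‖t‖ ^ 2 + y ^ 2 / s - 2 * (‖t‖ * y) = (s * ‖t‖ - y) ^ 2 / s := by
        field_simp; ring
      have h5 : 0 ≤ (s * ‖t‖ - y) ^ 2 / s := by positivity
      linarith
    have hfin : v k - (t • v j + T c) = v k - t • v j - T c := by abel
    rw [hfin]
    have h6 : s * ‖t‖ ^ 2 = ‖t‖ ^ 2 * ρ j - b' * ‖t‖ ^ 2 := by rw [hs]; ring
    dsimp only
    linarith

end Barrier

/-! ### Restricted invertibility -/

open Finset in
/-- Barrier induction: after `t` steps the barrier stands at `τ / (4n) - (t - 1) / (2n)` and the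
potential has dropped by at most `2 t`. The offset `t - 1` makes the barrier `τ / (4n)` at `t = 1`,
so that one vector can be selected however small `τ` is. -/
lemma exists_barrier_subset {H : Type*} [NormedAddCommGroup H] [InnerProductSpace ℂ H]
    [CompleteSpace H] {ι : Type*} [DecidableEq ι] (S : Finset ι)
    (v : ι → H) (hv : ∀ u, ∑ k ∈ S, ‖inner ℂ (v k) u‖ ^ 2 ≤ ‖u‖ ^ 2)
    (τ : ℝ) (hτ : τ = ∑ k ∈ S, ‖v k‖ ^ 2) (hτ0 : 0 < τ) (t : ℕ) (ht : 8 * ((t : ℝ) - 1) ≤ τ) :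
    ∃ σ ⊆ S, σ.card = t ∧ ∃ r : ι → ℝ, τ - 2 * t ≤ ∑ k ∈ S, r k ∧
      ∀ k ∈ S, ∀ c : ι → ℂ,
        r k + (τ / (4 * S.card) - (t - 1) / (2 * S.card)) * ∑ i ∈ σ, ‖c i‖ ^ 2 ≤
          ‖v k - ∑ i ∈ σ, c i • v i‖ ^ 2 := by
  have hn : (0 : ℝ) < S.card := by
    rcases S.eq_empty_or_nonempty with h | h
    · rw [h] at hτ; simp at hτ; linarith
    · exact_mod_cast h.card_pos
  induction t with
  | zero =>
    exact ⟨∅, by simp, by simp, fun k => ‖v k‖ ^ 2, by simp [hτ], by simp⟩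
  | succ t ih =>
    push_cast at ht
    obtain ⟨σ, hσS, hσt, r, hrsum, hr⟩ := ih (by linarith)
    set T : EuclideanSpace ℂ σ →ₗ[ℂ] H :=
      { toFun := fun c => ∑ i : σ, c i • v i
        map_add' := fun c e => by simp [add_smul, sum_add_distrib]
        map_smul' := fun a c => by simp [smul_smul, smul_sum] } with hT
    have hTa : ∀ c, T c = ∑ i : σ, c i • v i := fun c => rfl
    set b := τ / (4 * S.card) - ((t : ℝ) - 1) / (2 * S.card) with hb
    set b' := τ / (4 * S.card) - (((t + 1 : ℕ) : ℝ) - 1) / (2 * S.card) with hb'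
    have hdiff : b - b' = 1 / (2 * S.card) := by
      rw [hb, hb']; push_cast; field_simp; ring
    have hb'eq : S.card * b' = τ / 4 - t / 2 := by
      rw [hb']; push_cast; field_simp; ring
    have hb'pos : 0 < b' := by
      have : 0 < S.card * b' := by rw [hb'eq]; linarith
      exact pos_of_mul_pos_right this hn.le
    have hbb : b' < b := by
      have : 0 < 1 / (2 * (S.card : ℝ)) := by positivity
      linarith
    have hrT : ∀ k ∈ S, ∀ c, r k + b * ‖c‖ ^ 2 ≤ ‖v k - T c‖ ^ 2 := by
      intro k hk c
      have h1 := hr k hk (fun i => if h : i ∈ σ then c ⟨i, h⟩ else 0)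
      rw [← sum_coe_sort σ, ← sum_coe_sort σ] at h1
      simpa [hTa, EuclideanSpace.norm_sq_eq] using h1
    have ht0 : (0 : ℝ) ≤ t := by positivity
    obtain ⟨j, hj, r', hr'sum, hr'⟩ := barrier_step S v hv τ hτ hτ0 T r b b' hb'pos hbb hrT
      (by rw [hb'eq]; linarith) (by
        rw [hdiff]
        have : 2 * b' ≤ τ / (2 * S.card) := by
          rw [le_div_iff₀ (by positivity)]; linarith
        calc 2 * b' ≤ τ / (2 * S.card) := this
          _ = _ := by ring)
    have hjσ : j ∉ σ := by
      intro hjσ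
      -- otherwise `v j - T e_j = 0` contradicts the lower bound for the linear part
      have h1 := mul_norm_sq_le_of_shift (K := WithLp 2 (ℂ × EuclideanSpace ℂ σ))
        ((LinearMap.coprod (LinearMap.toSpanSingleton ℂ H (v j)) T).comp
          (WithLp.linearEquiv 2 ℂ (ℂ × EuclideanSpace ℂ σ)).toLinearMap) (v j) (r' j) b' (by
            intro c
            rw [WithLp.prod_norm_sq_eq_of_L2]
            simpa using hr' j hj c.snd c.fst)
        (WithLp.toLp 2 (-1, EuclideanSpace.single ⟨j, hjσ⟩ 1))
      rw [WithLp.prod_norm_sq_eq_of_L2] at h1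
      have h2 : T (EuclideanSpace.single ⟨j, hjσ⟩ 1) = v j := by
        rw [hTa, sum_eq_single ⟨j, hjσ⟩] <;> simp +contextual
      simp [h2] at h1
      linarith
    refine ⟨insert j σ, insert_subset hj hσS, by rw [card_insert_of_notMem hjσ, hσt], r', ?_, ?_⟩
    · push_cast; linarith
    · intro k hk c
      have h1 := hr' k hk (WithLp.toLp 2 fun i : σ => c i) (c j)
      rw [EuclideanSpace.norm_sq_eq, hTa] at h1
      rw [sum_insert hjσ, sum_insert hjσ]
      rw [← sum_coe_sort σ, ← sum_coe_sort σ]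
      exact h1

open Finset in
/-- Restricted invertibility with respect to a Bessel system: a system of `n` vectors with trace
`τ` has subsystems of size about `τ / 8` whose lower Riesz bound is `3 τ / (16 n)`. -/
lemma restricted_invertibility {H : Type*} [NormedAddCommGroup H] [InnerProductSpace ℂ H]
    [CompleteSpace H] {ι : Type*} [DecidableEq ι] (S : Finset ι)
    (v : ι → H) (hv : ∀ u, ∑ k ∈ S, ‖inner ℂ (v k) u‖ ^ 2 ≤ ‖u‖ ^ 2)
    (τ : ℝ) (hτ : τ = ∑ k ∈ S, ‖v k‖ ^ 2) (hτ0 : 0 < τ) (t : ℕ) (ht : 8 * ((t : ℝ) - 1) ≤ τ) :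
    ∃ σ ⊆ S, σ.card = t ∧ ∀ c : ι → ℂ,
      3 * τ / (16 * S.card) * ∑ i ∈ σ, ‖c i‖ ^ 2 ≤ ‖∑ i ∈ σ, c i • v i‖ ^ 2 := by
  obtain ⟨σ, hσS, hσt, r, -, hr⟩ := exists_barrier_subset S v hv τ hτ hτ0 t ht
  refine ⟨σ, hσS, hσt, fun c => ?_⟩
  have hne : S.Nonempty := by
    rcases S.eq_empty_or_nonempty with h | h
    · rw [h] at hτ; simp at hτ; linarith
    · exact h
  have hn : (0 : ℝ) < S.card := by exact_mod_cast hne.card_pos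
  obtain ⟨k, hk⟩ := hne
  have h1 := mul_norm_sq_le_of_shift (K := EuclideanSpace ℂ σ)
    { toFun := fun c => ∑ i : σ, c i • v i
      map_add' := fun c e => by simp [add_smul, sum_add_distrib]
      map_smul' := fun a c => by simp [smul_smul, smul_sum] } (v k) (r k) _ (by
        intro c
        have h1 := hr k hk (fun i => if h : i ∈ σ then c ⟨i, h⟩ else 0)
        rw [← sum_coe_sort σ, ← sum_coe_sort σ] at h1
        simpa [EuclideanSpace.norm_sq_eq] using h1) (WithLp.toLp 2 fun i : σ => c i)
  rw [EuclideanSpace.norm_sq_eq] at h1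
  rw [← sum_coe_sort σ, ← sum_coe_sort σ]
  refine le_trans (mul_le_mul_of_nonneg_right ?_ (sum_nonneg fun i _ => by positivity)) h1
  rw [← sub_nonneg]
  have : τ / (4 * S.card) - ((t : ℝ) - 1) / (2 * S.card) - 3 * τ / (16 * S.card) =
    (τ - 8 * (t - 1)) / (16 * S.card) := by field_simp; ring
  rw [this]
  exact div_nonneg (by linarith) (by positivity)

/-! ### Coordinates in unbiased bases -/

open Finset in
lemma IsUnbiased.norm_inner_sq_le {d : ℕ}
    {Φ Ψ : OrthonormalBasis (Fin d) ℂ (EuclideanSpace ℂ (Fin d))}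
    (h : IsUnbiased Φ Ψ) (j k : Fin d) : ‖inner ℂ (Ψ k) (Φ j)‖ ^ 2 ≤ 1 / (d : ℝ) := by
  have h1 : ‖inner ℂ (Φ j) (Ψ k)‖ ≤ 1 / √(d : ℝ) := by
    rw [← h]
    exact le_ciSup (f := fun p : Fin d × Fin d => ‖inner ℂ (Φ p.1) (Ψ p.2)‖)
      (Set.finite_range _).bddAbove (j, k)
  rw [norm_inner_symm]
  calc _ ≤ (1 / √(d : ℝ)) ^ 2 := by gcongr
    _ = _ := by rw [div_pow, Real.sq_sqrt (by positivity), one_pow]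

/-- The coordinates in the basis `Ψ`, set to zero outside `E`. -/
noncomputable def coordOn {d : ℕ} (Ψ : OrthonormalBasis (Fin d) ℂ (EuclideanSpace ℂ (Fin d)))
    (E : Finset (Fin d)) : EuclideanSpace ℂ (Fin d) →ₗ[ℂ] EuclideanSpace ℂ (Fin d) where
  toFun a := WithLp.toLp 2 fun k => if k ∈ E then Ψ.repr a k else 0
  map_add' a b := by ext k; by_cases h : k ∈ E <;> simp [h]
  map_smul' a b := by ext k; by_cases h : k ∈ E <;> simp [h]

section Coord

open Finset

variable {d : ℕ} (Ψ : OrthonormalBasis (Fin d) ℂ (EuclideanSpace ℂ (Fin d))) (E : Finset (Fin d))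

lemma norm_coordOn_sq (a : EuclideanSpace ℂ (Fin d)) :
    ‖coordOn Ψ E a‖ ^ 2 = ∑ k ∈ E, ‖Ψ.repr a k‖ ^ 2 := by
  have h : ∀ k, ‖coordOn Ψ E a k‖ ^ 2 = if k ∈ E then ‖Ψ.repr a k‖ ^ 2 else 0 := by
    intro k
    by_cases hk : k ∈ E <;> simp [coordOn, hk]
  rw [EuclideanSpace.norm_sq_eq, sum_congr rfl fun k _ => h k, sum_ite_mem, univ_inter]

lemma norm_coordOn (a : EuclideanSpace ℂ (Fin d)) : ‖coordOn Ψ E a‖ = basisNormOn Ψ E a := by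
  rw [basisNormOn, ← norm_coordOn_sq, Real.sqrt_sq (norm_nonneg _)]

lemma norm_sq_eq_sum_repr (a : EuclideanSpace ℂ (Fin d)) :
    ‖a‖ ^ 2 = ∑ k, ‖Ψ.repr a k‖ ^ 2 := by
  rw [← EuclideanSpace.norm_sq_eq, LinearIsometryEquiv.norm_map]

lemma norm_coordOn_le (a : EuclideanSpace ℂ (Fin d)) : ‖coordOn Ψ E a‖ ≤ ‖a‖ := by
  rw [← sq_le_sq₀ (norm_nonneg _) (norm_nonneg _), norm_coordOn_sq, norm_sq_eq_sum_repr Ψ a]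
  exact sum_le_sum_of_subset_of_nonneg (subset_univ _) fun _ _ _ => by positivity

/-- The truncated coordinate vectors of an orthonormal basis form a Bessel system: the truncation
is a contraction, hence so is its adjoint, and Parseval applies to the adjoint image of `u`. -/
lemma sum_norm_inner_coordOn_le (Φ : OrthonormalBasis (Fin d) ℂ (EuclideanSpace ℂ (Fin d)))
    (S : Finset (Fin d)) (u : EuclideanSpace ℂ (Fin d)) :
    ∑ j ∈ S, ‖inner ℂ (coordOn Ψ E (Φ j)) u‖ ^ 2 ≤ ‖u‖ ^ 2 := by
  have hadj : ∀ a, ‖inner ℂ (coordOn Ψ E a) u‖ = ‖inner ℂ a ((coordOn Ψ E).adjoint u)‖ := by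
    intro a; rw [LinearMap.adjoint_inner_right]
  have hle : ‖(coordOn Ψ E).adjoint u‖ ≤ ‖u‖ := by
    set w := (coordOn Ψ E).adjoint u
    have h1 : ‖w‖ ^ 2 ≤ ‖w‖ * ‖u‖ := by
      calc ‖w‖ ^ 2 = ‖inner ℂ w w‖ := by
            rw [inner_self_eq_norm_sq_to_K]; simp
        _ = ‖inner ℂ (coordOn Ψ E w) u‖ := (hadj w).symm
        _ ≤ ‖coordOn Ψ E w‖ * ‖u‖ := norm_inner_le_norm _ _
        _ ≤ ‖w‖ * ‖u‖ := by gcongr; exact norm_coordOn_le _ _ _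
    by_contra! hlt
    have : 0 < ‖w‖ := (norm_nonneg u).trans_lt hlt
    nlinarith
  simp only [hadj]
  calc _ ≤ ∑ j, ‖inner ℂ (Φ j) ((coordOn Ψ E).adjoint u)‖ ^ 2 :=
        sum_le_sum_of_subset_of_nonneg (subset_univ _) fun _ _ _ => by positivity
    _ = ‖(coordOn Ψ E).adjoint u‖ ^ 2 := Φ.sum_sq_norm_inner_right _
    _ ≤ _ := by gcongr

/-- Each coordinate has squared modulus at most `1 / d`, so those on `E` carry at most `|E| / d` of
the total mass `1`. -/
lemma IsUnbiased.le_norm_coordOn_sq {Φ Ψ : OrthonormalBasis (Fin d) ℂ (EuclideanSpace ℂ (Fin d))}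
    (h : IsUnbiased Φ Ψ) (E : Finset (Fin d)) (j : Fin d) :
    1 - (E.card : ℝ) / d ≤ ‖coordOn Ψ Eᶜ (Φ j)‖ ^ 2 := by
  have h1 := norm_sq_eq_sum_repr Ψ (Φ j)
  rw [Φ.norm_eq_one, one_pow, ← sum_add_sum_compl E] at h1
  have h2 : ∑ k ∈ E, ‖Ψ.repr (Φ j) k‖ ^ 2 ≤ E.card * (1 / (d : ℝ)) := by
    rw [← nsmul_eq_mul]
    refine sum_le_card_nsmul _ _ _ fun k _ => ?_
    rw [Ψ.repr_apply_apply]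
    exact h.norm_inner_sq_le j k
  rw [norm_coordOn_sq]
  rw [mul_one_div] at h2
  linarith

lemma basisNormOn_eq_norm_sum (a : EuclideanSpace ℂ (Fin d)) :
    basisNormOn Ψ E a = ‖∑ i ∈ E, Ψ.repr a i • Ψ i‖ := by
  rw [← norm_coordOn, ← Ψ.repr.norm_map (∑ i ∈ E, _)]
  congr 1
  ext k
  simp [coordOn, Pi.single_apply]

end Coord

/-! ### The uncertainty inequality -/

theorem proposition2p7 (d : ℕ)
    (Φ Ψ : OrthonormalBasis (Fin d) ℂ (EuclideanSpace ℂ (Fin d)))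
    (hunb : IsUnbiased Φ Ψ)
    (S Sigma : Finset (Fin d))
    (hcard : S.card + Sigma.card = d)
    (hSigma : Sigma.card < d) :
    ∃ σ : Finset (Fin d), σ ⊆ S ∧
      ((d : ℝ) - (Sigma.card : ℝ)) ^ 2 / (240 * (d : ℝ)) ≤ (σ.card : ℝ) ∧
      ∀ a : EuclideanSpace ℂ (Fin d),
        ‖a‖ ≤ 13 / √(1 - (Sigma.card : ℝ) / (d : ℝ)) *
          (basisNormOn Φ σᶜ a + basisNormOn Ψ Sigmaᶜ a) := by
  have hd : (0 : ℝ) < d := by exact_mod_cast (Nat.zero_le _).trans_lt hSigma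
  have hm : (S.card : ℝ) = d - Sigma.card := by
    rw [eq_sub_iff_add_eq]; exact_mod_cast hcard
  have hm0 : (0 : ℝ) < S.card := by
    rw [hm, sub_pos]; exact_mod_cast hSigma
  set β : ℝ := 1 - (Sigma.card : ℝ) / d with hβ
  have hβm : β = S.card / d := by rw [hβ, hm]; field_simp
  have hβ0 : 0 < β := by rw [hβm]; positivity
  have hβ1 : β ≤ 1 := by
    have : 0 ≤ (Sigma.card : ℝ) / d := by positivity
    linarith
  set v : Fin d → EuclideanSpace ℂ (Fin d) := fun j => coordOn Ψ Sigmaᶜ (Φ j) with hv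
  set τ := ∑ j ∈ S, ‖v j‖ ^ 2 with hτ
  have hτβ : S.card * β ≤ τ := by
    rw [← nsmul_eq_mul]
    exact Finset.card_nsmul_le_sum _ _ _ fun j _ => hunb.le_norm_coordOn_sq Sigma j
  have hmβ : 0 < S.card * β := by positivity
  have hgoal : ((d : ℝ) - (Sigma.card : ℝ)) ^ 2 / (240 * (d : ℝ)) = S.card * β / 240 := by
    rw [hβm, ← hm]; field_simp
  obtain ⟨σ, hσS, hσt, hσ⟩ := restricted_invertibility S v
    (sum_norm_inner_coordOn_le Ψ Sigmaᶜ Φ S) τ hτ (by linarith) ⌈S.card * β / 240⌉₊ (by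
      have := Nat.ceil_lt_add_one (a := S.card * β / 240) (by positivity)
      linarith)
  refine ⟨σ, hσS, ?_, fun a => ?_⟩
  · rw [hgoal, hσt]; exact Nat.le_ceil _
  set x := ∑ i ∈ σ, Φ.repr a i • Φ i with hx
  set y := ∑ i ∈ σᶜ, Φ.repr a i • Φ i with hy
  have hxy : a = x + y := by rw [hx, hy, Finset.sum_add_sum_compl, Φ.sum_repr]
  have hPx : coordOn Ψ Sigmaᶜ x = ∑ i ∈ σ, Φ.repr a i • v i := by
    rw [hx, map_sum]
    exact Finset.sum_congr rfl fun i _ => map_smul _ _ _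
  have hlow : √β / 4 * ‖x‖ ≤ ‖coordOn Ψ Sigmaᶜ x‖ := by
    rw [← sq_le_sq₀ (by positivity) (norm_nonneg _), mul_pow, div_pow, Real.sq_sqrt hβ0.le, hPx]
    refine le_trans ?_ (hσ _)
    rw [hx, ← basisNormOn_eq_norm_sum, basisNormOn, Real.sq_sqrt (by positivity)]
    refine mul_le_mul_of_nonneg_right ?_ (Finset.sum_nonneg fun i _ => by positivity)
    rw [div_le_div_iff₀ (by norm_num) (mul_pos (by norm_num) hm0)]
    nlinarith
  have hup : ‖coordOn Ψ Sigmaᶜ x‖ ≤ basisNormOn Ψ Sigmaᶜ a + ‖y‖ := by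
    have h1 : x = a - y := eq_sub_of_add_eq hxy.symm
    rw [← norm_coordOn, h1, map_sub]
    exact (norm_sub_le _ _).trans (by gcongr; exact norm_coordOn_le _ _ _)
  rw [basisNormOn_eq_norm_sum Φ σᶜ a, ← hy]
  have hs0 : 0 < √β := Real.sqrt_pos.2 hβ0
  have hs1 : √β ≤ 1 := Real.sqrt_le_one.2 hβ1
  have hN : 0 ≤ basisNormOn Ψ Sigmaᶜ a := Real.sqrt_nonneg _
  have htri : ‖a‖ ≤ ‖x‖ + ‖y‖ := by rw [hxy]; exact norm_add_le _ _
  rw [div_mul_eq_mul_div, le_div_iff₀ hs0]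
  nlinarith [norm_nonneg y, norm_nonneg x]
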